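/- Let $V$ be a nonempty finite set, let $r \ge 1$, let $\mathcal{M}_1,\dots,\mathcal{M}_r$ be matroids on the ground set $V$ with rank functions $\mathrm{rk}_{\mathcal{M}_i}$, and let $k>0$ be real. Call $c : 2^V \to \mathbb{R}$ PDS if it is positive ($c(A)>0$ for all $A\subseteq V$), decreasing ($c(A)\ge c(B)$ whenever $A\subseteq B$) and submodular ($c(A)+c(B)\ge c(A\cup B)+c(A\cap B)$). For such $c$ and a matroid $\mathcal{M}$ on $V$ let $$P_c(\mathcal{M}) = \Big\{ f \in \mathbb{R}_{\ge 0}^V : \sum_{v\in A} f(v) \le c(A)\,\mathrm{rk}_{\mathcal{M}}(A) \text{ for every } \emptyset\ne A\subseteq V\Big\}.$$ Let $\mathbf{a}=(a_v)_{v\in V}$ with $a_v>0$ for all $v$, and let $\mathbf{b}=(b^1,\dots,b^r)$ be an $r$-tuple of PDS functions. For $W\subseteq V$ put $$\nu^*_{\mathbf a,\mathbf b}(W)=\max\Big\{\sum_{v\in V}a_v f(v) : f\in\bigcap_{i=1}^r P_{b^i}(\mathcal{M}_i),\ \mathrm{supp}(f)\subseteq W\Big\},$$ and let $\mathcal{X}_{\mathbf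 a,\mathbf b,k}$ be the simplicial complex of all $W\subseteq V$ with $\nu^*_{\mathbf a,\mathbf b}(W)<k$. Let $\underline{a}=\min_{v\in V}a_v$ and $\underline{b}=\min_{1\le i\le r}b^i(V)$. Then the maximum $\overline{k}:=\max\{\nu^*_{\mathbf a,\mathbf b}(W) : W\in\mathcal{X}_{\mathbf a,\mathbf b,k}\}$ exists and satisfies $\overline{k}<k$, and $\mathcal{X}_{\mathbf a,\mathbf b,k}$ is $r\left\lfloor \frac{\overline{k}}{\underline{a}\,\underline{b}}\right\rfloor$-collapsible. Here a complex is a downward-closed collection $\mathcal{C}$ of subsets of $V$ (its faces, the empty set included when $\mathcal{C}$ is nonempty). A $d$-collapse removes from $\mathcal{C}$ all faces containing a given face $\sigma$ that has $|\sigma|\le d$ and lies in a unique maximal face of $\mathcal{C}$; and $\mathcal{C}$ is $d$-collapsible if a finite sequence of $d$-collapses reduces it to the complex with no faces. -/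

import Mathlib

/-- The rank in `M` of a finite set `A`, as a natural number (`eRk A` is finite, at most `#A`). -/
noncomputable def matroidRank {V : Type*} (M : Matroid V) (A : Finset V) : ℕ :=
  (M.eRk (A : Set V)).toNat

/-- Positive, decreasing and submodular (PDS) functions on the subsets of `V`. -/
structure IsPDS {V : Type*} [DecidableEq V] (c : Finset V → ℝ) : Prop where
  pos : ∀ A, 0 < c A
  decreasing : ∀ A B, A ⊆ B → c B ≤ c A
  submodular : ∀ A B, c (A ∪ B) + c (A ∩ B) ≤ c A + c B

/-- The skewed matroid polytope `P_c(M)`. -/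
def skewPolytope {V : Type*} (c : Finset V → ℝ) (M : Matroid V) : Set (V → ℝ) :=
  {f | (∀ v, 0 ≤ f v) ∧
    ∀ A : Finset V, A.Nonempty → ∑ v ∈ A, f v ≤ c A * (matroidRank M A : ℝ)}

/-- The functions in `⋂ i, P_{b i}(M i)` whose support is contained in `W`. -/
def fracFeasible {V : Type*} {r : ℕ} (M : Fin r → Matroid V) (b : Fin r → Finset V → ℝ)
    (W : Finset V) : Set (V → ℝ) :=
  {f | f ∈ ⋂ i, skewPolytope (b i) (M i) ∧ Function.support f ⊆ (W : Set V)}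

/-- The fractional value `ν*_{a,b}(W)`: the largest value of `∑ v, a v * f v` over the feasible
functions supported in `W` (see `fracValue_isGreatest` for the fact that it is attained). -/
noncomputable def fracValue {V : Type*} [Fintype V] {r : ℕ} (M : Fin r → Matroid V)
    (a : V → ℝ) (b : Fin r → Finset V → ℝ) (W : Finset V) : ℝ :=
  sSup ((fun f : V → ℝ => ∑ v, a v * f v) '' fracFeasible M b W)

theorem fracFeasible_mono {V : Type*} {r : ℕ} (M : Fin r → Matroid V)
    (b : Fin r → Finset V → ℝ) {W W' : Finset V} (h : W ⊆ W') :
    fracFeasible M b W ⊆ fracFeasible M b W' :=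
  fun _ hf => ⟨hf.1, hf.2.trans (Finset.coe_subset.2 h)⟩

theorem fracFeasible_isCompact {V : Type*} [Fintype V] {r : ℕ} [NeZero r]
    (M : Fin r → Matroid V) (b : Fin r → Finset V → ℝ) (W : Finset V) :
    IsCompact (fracFeasible M b W) := by
  have hsub : fracFeasible M b W ⊆
      Set.Icc (0 : V → ℝ) (fun v => b 0 {v} * (matroidRank (M 0) {v} : ℝ)) := by
    rintro f ⟨hf, -⟩
    have h0 := Set.mem_iInter.1 hf 0
    refine ⟨fun v => h0.1 v, fun v => ?_⟩
    simpa using h0.2 {v} (Finset.singleton_nonempty v)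
  refine IsCompact.of_isClosed_subset isCompact_Icc ?_ hsub
  have heq : fracFeasible M b W =
      (⋂ i, ((⋂ v, {f : V → ℝ | 0 ≤ f v}) ∩ ⋂ A : Finset V, ⋂ _ : A.Nonempty,
        {f : V → ℝ | ∑ v ∈ A, f v ≤ b i A * (matroidRank (M i) A : ℝ)})) ∩
      ⋂ v : V, ⋂ _ : v ∉ W, {f : V → ℝ | f v = 0} := by
    ext f
    simp only [fracFeasible, skewPolytope, Set.mem_ofPred_eq, Set.mem_iInter, Set.mem_inter_iff,
      Function.support_subset_iff', Finset.mem_coe]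
  rw [heq]
  refine IsClosed.inter (isClosed_iInter fun i => IsClosed.inter
    (isClosed_iInter fun v => isClosed_le (by fun_prop) (by fun_prop))
    (isClosed_iInter fun A => isClosed_iInter fun _ =>
      isClosed_le (by fun_prop) (by fun_prop)))
    (isClosed_iInter fun v => isClosed_iInter fun _ => isClosed_eq (by fun_prop) (by fun_prop))

/-- `ν*_{a,b}(W)` is a maximum. -/
theorem fracValue_isGreatest {V : Type*} [Fintype V] {r : ℕ} [NeZero r]
    (M : Fin r → Matroid V) (a : V → ℝ) (b : Fin r → Finset V → ℝ)
    (hb : ∀ i A, 0 ≤ b i A) (W : Finset V) :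
    IsGreatest ((fun f : V → ℝ => ∑ v, a v * f v) '' fracFeasible M b W)
      (fracValue M a b W) := by
  have hne : (fracFeasible M b W).Nonempty := by
    refine ⟨0, Set.mem_iInter.2 fun i => ⟨fun v => le_rfl, fun A _ => ?_⟩, by simp⟩
    simpa using mul_nonneg (hb i A) (Nat.cast_nonneg _)
  exact ((fracFeasible_isCompact M b W).image (by fun_prop)).isGreatest_sSup (hne.image _)

theorem fracValue_mono {V : Type*} [Fintype V] {r : ℕ} [NeZero r]
    (M : Fin r → Matroid V) (a : V → ℝ) (b : Fin r → Finset V → ℝ)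
    (hb : ∀ i A, 0 ≤ b i A) {W W' : Finset V} (h : W ⊆ W') :
    fracValue M a b W ≤ fracValue M a b W' :=
  (fracValue_isGreatest M a b hb W').2
    (Set.image_mono (fracFeasible_mono M b h) (fracValue_isGreatest M a b hb W).1)

/-- The complex `X_{a,b,k}` of all `W ⊆ V` with `ν*_{a,b}(W) < k`. A complex on `V` is a
downward-closed collection of subsets of `V`, that is, a `LowerSet (Finset V)`. -/
noncomputable def fracComplex {V : Type*} [Fintype V] {r : ℕ} [NeZero r]
    (M : Fin r → Matroid V) (a : V → ℝ) (b : Fin r → Finset V → ℝ)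
    (hb : ∀ i A, 0 ≤ b i A) (k : ℝ) : LowerSet (Finset V) where
  carrier := {W | fracValue M a b W < k}
  lower' := fun _ _ h hW => (fracValue_mono M a b hb h).trans_lt hW

/-- A collapsor: a face contained in a unique maximal face. -/
def IsCollapsor {V : Type*} (C : LowerSet (Finset V)) (σ : Finset V) : Prop :=
  σ ∈ C ∧ ∃! τ : Finset V, Maximal (fun ρ => ρ ∈ C) τ ∧ σ ⊆ τ

/-- `C'` arises from `C` by a `d`-collapse: `C' = C.erase σ` consists of the faces of `C` that
do not contain the collapsor `σ`, where `σ` has at most `d` elements. -/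
def IsDCollapse {V : Type*} (d : ℕ) (C C' : LowerSet (Finset V)) : Prop :=
  ∃ σ : Finset V, IsCollapsor C σ ∧ σ.card ≤ d ∧ C' = C.erase σ

/-- `C` can be reduced by a finite sequence of `d`-collapses to the complex `⊥` with no faces. -/
def IsDCollapsible {V : Type*} (d : ℕ) (C : LowerSet (Finset V)) : Prop :=
  Relation.ReflTransGen (IsDCollapse d) C ⊥

/-!
The collapses are found by linear programming for a slightly increased, generic pair `(a', b')`.
Since `b' ≥ b` and `a' ≥ a` exceed `b` and `a` by a factor close to `1`, the complex does not change
(`fracValue_le_of_le`, `fracValue_le_mul_of_le_mul`), and neither does the integer part in the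
bound. The perturbed functions are strictly decreasing and strictly submodular, and genericity
gives two more properties (`exists_isStrictPDS_isNondegenerate`, `exists_weight_injOn_isVertex`):
the tight constraints of positive rank at a point of the polytope, restricted to its support, are
linearly independent, and distinct vertices have distinct values.

Let `f` be the vertex of largest value `m < k` that is optimal for some face, and `σ` its support.
* The faces containing `σ` are exactly those of value `m`: an optimal vertex of a face of value `m`
  has the same value as `f`, hence equals `f`.
* The union of two faces `U`, `U'` containing `σ` is a face
  (`IsNondegenerate.sum_mul_le_of_union`): `f` is optimal for both, and a feasible direction at `f`
  supported in `U ∪ U'` is the sum of one supported in `U` and one supported in `U'`, where linear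
  independence provides the correction on `σ` that keeps the tight constraints satisfied. So `σ`
  lies in a unique maximal face.
* For each matroid, the tight sets of positive rank form a chain, because `c(A) rk(A)` is strictly
  submodular, and their ranks are distinct, because `c` is strictly decreasing. A tight set `A` has
  `b(V) rk(A) ≤ f(A)`, so its rank is at most the integer part in the theorem, and a vertex has no
  more nonzero coordinates than there are tight sets (`IsVertex.card_support_le`).

So removing all faces that contain `σ` is a `d`-collapse, which turns the complex of bound `k` into
the one of bound `m`; induction on the number of faces finishes the proof
(`isDCollapsible_of_isNondegenerate`).
-/

open Filter Topology

/-! ### Rank in a matroid as a natural number -/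

theorem coe_matroidRank {V : Type*} (M : Matroid V) (A : Finset V) :
    (matroidRank M A : ℕ∞) = M.eRk (A : Set V) :=
  ENat.natCast_toNat (((M.eRk_le_encard A).trans_lt (by simp)).ne)

theorem matroidRank_mono {V : Type*} (M : Matroid V) {A B : Finset V} (h : A ⊆ B) :
    matroidRank M A ≤ matroidRank M B := by
  have := M.eRk_mono (Finset.coe_subset.2 h)
  rw [← coe_matroidRank, ← coe_matroidRank] at this
  exact_mod_cast this

theorem matroidRank_inter_add_union_le {V : Type*} [DecidableEq V] (M : Matroid V)
    (A B : Finset V) :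
    matroidRank M (A ∩ B) + matroidRank M (A ∪ B) ≤ matroidRank M A + matroidRank M B := by
  have := M.eRk_inter_add_eRk_union_le (A : Set V) (B : Set V)
  rw [← Finset.coe_inter, ← Finset.coe_union] at this
  simp only [← coe_matroidRank] at this
  exact_mod_cast this

/-! ### Strictly positive, decreasing and submodular functions -/

/-- A PDS function whose monotonicity is strict on strict inclusions, and whose submodularity is
strict on pairs that are not comparable under inclusion. -/
structure IsStrictPDS {V : Type*} [DecidableEq V] (c : Finset V → ℝ) : Prop where
  pos : ∀ A, 0 < c A
  decreasing : ∀ A B, A ⊂ B → c B < c A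
  submodular : ∀ A B, ¬ A ⊆ B → ¬ B ⊆ A → c (A ∪ B) + c (A ∩ B) < c A + c B

/-- The product of a strictly PDS function and a matroid rank function is strictly submodular on
incomparable pairs, as soon as one of the two sets has positive rank. -/
theorem IsStrictPDS.mul_matroidRank_lt {V : Type*} [DecidableEq V] {c : Finset V → ℝ}
    (hc : IsStrictPDS c) (M : Matroid V) {A B : Finset V} (hAB : ¬ A ⊆ B) (hBA : ¬ B ⊆ A)
    (hA : 0 < matroidRank M A) :
    c (A ∪ B) * matroidRank M (A ∪ B) + c (A ∩ B) * matroidRank M (A ∩ B) <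
      c A * matroidRank M A + c B * matroidRank M B := by
  have h1 : c (A ∪ B) < c A := hc.decreasing _ _
    ⟨Finset.subset_union_left, fun h => hBA (Finset.subset_union_right.trans h)⟩
  have h2 : c (A ∪ B) < c B := hc.decreasing _ _
    ⟨Finset.subset_union_right, fun h => hAB (Finset.subset_union_left.trans h)⟩
  have h3 := hc.submodular A B hAB hBA
  have hp := hc.pos (A ∪ B)
  have r1 : (matroidRank M (A ∩ B) : ℝ) ≤ matroidRank M A :=
    Nat.cast_le.2 (matroidRank_mono M Finset.inter_subset_left)
  have r2 : (matroidRank M (A ∩ B) : ℝ) ≤ matroidRank M B :=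
    Nat.cast_le.2 (matroidRank_mono M Finset.inter_subset_right)
  have r3 : (matroidRank M (A ∩ B) : ℝ) + matroidRank M (A ∪ B) ≤
      matroidRank M A + matroidRank M B := by
    exact_mod_cast matroidRank_inter_add_union_le M A B
  have r4 : (0 : ℝ) ≤ matroidRank M (A ∩ B) := Nat.cast_nonneg _
  have r5 : (0 : ℝ) < matroidRank M A := Nat.cast_pos.2 hA
  have e1 := mul_nonneg hp.le (sub_nonneg.2 r3)
  have e2 := mul_nonneg (sub_nonneg.2 h1.le) (sub_nonneg.2 r1)
  have e3 := mul_nonneg (sub_nonneg.2 h2.le) (sub_nonneg.2 r2)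
  rcases r4.eq_or_lt with h0 | h0
  · have e4 := mul_pos (sub_pos.2 h1) r5
    rw [← h0] at e1 e2 e3 ⊢
    nlinarith
  · have e4 := mul_pos (sub_pos.2 h3) h0
    nlinarith

/-- Strictly PDS functions are reached from PDS functions by an arbitrarily small increase: adding
a small multiple of the strictly PDS function `A ↦ n ^ 2 + 1 - #A ^ 2`, where `n = #V`. -/
theorem IsPDS.exists_isStrictPDS {V : Type*} [Fintype V] [DecidableEq V] {c : Finset V → ℝ}
    (hc : IsPDS c) {ε : ℝ} (hε : 0 < ε) :
    ∃ c', IsStrictPDS c' ∧ ∀ A, c A < c' A ∧ c' A < (1 + ε) * c A := by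
  set N : ℝ := (Fintype.card V : ℝ) ^ 2 + 1 with hN
  have hcard : ∀ A : Finset V, ((A.card : ℝ)) ^ 2 + 1 ≤ N := fun A => by
    have : (A.card : ℝ) ≤ Fintype.card V := by exact_mod_cast A.card_le_univ
    have := pow_le_pow_left₀ (Nat.cast_nonneg _) this 2
    linarith
  have hN0 : 0 < N := by positivity
  have hu : 0 < c Finset.univ := hc.pos _
  set s : ℝ := ε * c Finset.univ / (2 * N) with hs
  have hs0 : 0 < s := by positivity
  have hsN : s * N < ε * c Finset.univ := by
    have : s * N = ε * c Finset.univ / 2 := by rw [hs]; field_simp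
    rw [this]; linarith [mul_pos hε hu]
  refine ⟨fun A => c A + s * (N - (A.card : ℝ) ^ 2), ⟨fun A => ?_, fun A B h => ?_,
    fun A B hAB hBA => ?_⟩, fun A => ⟨?_, ?_⟩⟩
  · have := hc.pos A
    have := mul_pos hs0 (show 0 < N - (A.card : ℝ) ^ 2 by linarith [hcard A])
    linarith
  · have h1 := hc.decreasing A B h.subset
    have h2 : (A.card : ℝ) < B.card := by exact_mod_cast Finset.card_lt_card h
    have h3 : (A.card : ℝ) ^ 2 < (B.card : ℝ) ^ 2 := by gcongr
    have := mul_lt_mul_of_pos_left h3 hs0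
    linarith
  · have h1 := hc.submodular A B
    have h2 : ((A ∪ B).card : ℝ) + (A ∩ B).card = A.card + B.card := by
      exact_mod_cast Finset.card_union_add_card_inter A B
    have h3 : (A.card : ℝ) < (A ∪ B).card := by
      exact_mod_cast Finset.card_lt_card
        ⟨Finset.subset_union_left, fun h => hBA (Finset.subset_union_right.trans h)⟩
    have h4 : (B.card : ℝ) < (A ∪ B).card := by
      exact_mod_cast Finset.card_lt_card
        ⟨Finset.subset_union_right, fun h => hAB (Finset.subset_union_left.trans h)⟩
    have h5 : ((A ∩ B).card : ℝ) = A.card + B.card - (A ∪ B).card := by linarith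
    have h6 := mul_pos hs0 (mul_pos (sub_pos.2 h3) (sub_pos.2 h4))
    simp only [h5]
    nlinarith
  · have := mul_pos hs0 (show 0 < N - (A.card : ℝ) ^ 2 by linarith [hcard A])
    simp only
    linarith
  · have h1 : s * (N - (A.card : ℝ) ^ 2) ≤ s * N := by
      gcongr
      linarith [sq_nonneg (A.card : ℝ)]
    have h2 := hc.decreasing A _ A.subset_univ
    have h3 := mul_le_mul_of_nonneg_left h2 hε.le
    simp only
    linarith

/-! ### Tight constraints and vertices -/

section Polytope

variable {V : Type*} [Fintype V] {r : ℕ} {M : Fin r → Matroid V} {b : Fin r → Finset V → ℝ}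

/-- The constraint of the pair `p = (i, A)`, that is, of the nonempty set `A` in the polytope of
the `i`-th matroid, holds with equality at `f`. -/
def IsTight {V : Type*} {r : ℕ} (M : Fin r → Matroid V) (b : Fin r → Finset V → ℝ) (f : V → ℝ)
    (p : Fin r × Finset V) : Prop :=
  p.2.Nonempty ∧ ∑ v ∈ p.2, f v = b p.1 p.2 * (matroidRank (M p.1) p.2 : ℝ)

/-- A vertex of the polytope `⋂ i, P_{b i}(M i)`, described through its constraints: the only
direction along which every constraint that is tight at `f` (nonnegativity included) stays tight
is `0`. -/
def IsVertex {V : Type*} {r : ℕ} (M : Fin r → Matroid V) (b : Fin r → Finset V → ℝ)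
    (f : V → ℝ) : Prop :=
  f ∈ ⋂ i, skewPolytope (b i) (M i) ∧
    ∀ g : V → ℝ, Function.support g ⊆ Function.support f →
      (∀ p, IsTight M b f p → ∑ v ∈ p.2, g v = 0) → g = 0

/-- The nondegeneracy that generic bounds `b` provide: at every point `f` of the polytope, the
tight constraints of positive rank, restricted to the support of `f`, are linearly independent;
equivalently, vectors supported in the support of `f` take arbitrary values on them. -/
def IsNondegenerate {V : Type*} {r : ℕ} (M : Fin r → Matroid V)
    (b : Fin r → Finset V → ℝ) : Prop :=
  ∀ f ∈ ⋂ i, skewPolytope (b i) (M i), ∀ z : Fin r × Finset V → ℝ,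
    ∃ w : V → ℝ, Function.support w ⊆ Function.support f ∧
      ∀ p, IsTight M b f p → 0 < matroidRank (M p.1) p.2 → ∑ v ∈ p.2, w v = z p

theorem mem_iInter_skewPolytope {V : Type*} {r : ℕ} [NeZero r] {M : Fin r → Matroid V}
    {b : Fin r → Finset V → ℝ} {f : V → ℝ} :
    f ∈ ⋂ i, skewPolytope (b i) (M i) ↔ (∀ v, 0 ≤ f v) ∧
      ∀ p : Fin r × Finset V, p.2.Nonempty →
        ∑ v ∈ p.2, f v ≤ b p.1 p.2 * (matroidRank (M p.1) p.2 : ℝ) := by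
  rw [Set.mem_iInter]
  exact ⟨fun h => ⟨(h 0).1, fun p => (h p.1).2 p.2⟩, fun h i => ⟨h.1, fun A => h.2 (i, A)⟩⟩

theorem eq_zero_of_matroidRank_eq_zero {V : Type*} {r : ℕ} [NeZero r] {M : Fin r → Matroid V}
    {b : Fin r → Finset V → ℝ} {f : V → ℝ}
    (hf : f ∈ ⋂ i, skewPolytope (b i) (M i)) {p : Fin r × Finset V}
    (hp : matroidRank (M p.1) p.2 = 0) {v : V} (hv : v ∈ p.2) : f v = 0 := by
  obtain ⟨h0, h1⟩ := mem_iInter_skewPolytope.1 hf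
  have h2 := h1 p ⟨v, hv⟩
  rw [hp, Nat.cast_zero, mul_zero] at h2
  exact le_antisymm ((Finset.single_le_sum (fun i _ => h0 i) hv).trans h2) (h0 v)

theorem eventually_add_smul_mem [NeZero r] {f d : V → ℝ}
    (hf : f ∈ ⋂ i, skewPolytope (b i) (M i)) (hd0 : ∀ v, f v = 0 → 0 ≤ d v)
    (hdT : ∀ p, IsTight M b f p → ∑ v ∈ p.2, d v ≤ 0) :
    ∀ᶠ t in 𝓝[>] (0 : ℝ), f + t • d ∈ ⋂ i, skewPolytope (b i) (M i) := by
  obtain ⟨h0, h1⟩ := mem_iInter_skewPolytope.1 hf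
  have hlim : ∀ x y : ℝ, Tendsto (fun t : ℝ => x + t * y) (𝓝[>] 0) (𝓝 x) := fun x y => by
    have : Continuous fun t : ℝ => x + t * y := by fun_prop
    simpa using (this.tendsto 0).mono_left nhdsWithin_le_nhds
  simp only [mem_iInter_skewPolytope, Pi.add_apply, Pi.smul_apply, smul_eq_mul,
    Finset.sum_add_distrib, ← Finset.mul_sum]
  refine Filter.Eventually.and (eventually_all.2 fun v => ?_) (eventually_all.2 fun p => ?_)
  · rcases (h0 v).eq_or_lt with h | h
    · filter_upwards [self_mem_nhdsWithin] with t ht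
      rw [← h, zero_add]
      exact mul_nonneg (le_of_lt ht) (hd0 v h.symm)
    · filter_upwards [(hlim (f v) (d v)).eventually_const_lt h] with t ht using ht.le
  · by_cases hp : p.2.Nonempty
    · rcases (h1 p hp).eq_or_lt with h | h
      · filter_upwards [self_mem_nhdsWithin] with t ht _
        have := mul_nonpos_of_nonneg_of_nonpos (le_of_lt ht) (hdT p ⟨hp, h⟩)
        linarith
      · filter_upwards [(hlim _ (∑ v ∈ p.2, d v)).eventually_lt_const h] with t ht _ using ht.le
    · exact Eventually.of_forall fun t h => absurd h hp

/-- A linear objective that is maximal at `f` among the feasible points supported in `U` does not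
increase along any feasible direction supported in `U`. -/
theorem sum_mul_nonpos_of_direction [NeZero r] {a f d : V → ℝ} {U : Finset V}
    (hf : f ∈ fracFeasible M b U)
    (hopt : ∀ f' ∈ fracFeasible M b U, ∑ v, a v * f' v ≤ ∑ v, a v * f v)
    (hdU : Function.support d ⊆ U) (hd0 : ∀ v, f v = 0 → 0 ≤ d v)
    (hdT : ∀ p, IsTight M b f p → ∑ v ∈ p.2, d v ≤ 0) :
    ∑ v, a v * d v ≤ 0 := by
  obtain ⟨t, ht, ht0⟩ := ((eventually_add_smul_mem hf.1 hd0 hdT).and self_mem_nhdsWithin).exists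
  have h := hopt (f + t • d) ⟨ht, (Function.support_add _ _).trans (Set.union_subset hf.2
    ((Function.support_const_smul_subset _ _).trans hdU))⟩
  have h2 : ∑ v, a v * (f + t • d) v = ∑ v, a v * f v + t * ∑ v, a v * d v := by
    rw [Finset.mul_sum, ← Finset.sum_add_distrib]
    exact Finset.sum_congr rfl fun v _ => by
      simp only [Pi.add_apply, Pi.smul_apply, smul_eq_mul]; ring
  rw [h2] at h
  exact nonpos_of_mul_nonpos_right (by linarith) ht0

theorem finite_setOf_isVertex (M : Fin r → Matroid V) (b : Fin r → Finset V → ℝ) :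
    {f | IsVertex M b f}.Finite := by
  refine Set.Finite.of_finite_image (f := fun f => (Function.support f, {p | IsTight M b f p}))
    (Set.toFinite _) fun f hf f' hf' h => ?_
  obtain ⟨h1, h2⟩ := Prod.mk.inj h
  refine sub_eq_zero.1 (hf.2 (f - f') ?_ fun p hp => ?_)
  · exact (Function.support_sub _ _).trans (by rw [← h1, Set.union_self])
  · have hp' : IsTight M b f' p := by
      have : p ∈ {p | IsTight M b f p} := hp
      rwa [h2] at this
    simp only [Pi.sub_apply, Finset.sum_sub_distrib]
    rw [hp.2, hp'.2, sub_self]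

/-- The value `ν*_{a,b}(W)` is attained at a vertex, namely at an extreme point of the compact
convex set of optimal solutions. -/
theorem exists_isVertex_sum_eq_fracValue [NeZero r] (a : V → ℝ) (hb : ∀ i A, 0 ≤ b i A)
    (W : Finset V) :
    ∃ f ∈ fracFeasible M b W, IsVertex M b f ∧ ∑ v, a v * f v = fracValue M a b W := by
  have hgr := fracValue_isGreatest M a b hb W
  set F := fracFeasible M b W ∩ {f | ∑ v, a v * f v = fracValue M a b W} with hF
  have hFc : IsCompact F := (fracFeasible_isCompact M b W).inter_right
    (isClosed_eq (by fun_prop) (by fun_prop))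
  have hFne : F.Nonempty := by
    obtain ⟨f, hf, hf'⟩ := hgr.1
    exact ⟨f, hf, hf'⟩
  obtain ⟨f, hfF⟩ := hFc.extremePoints_nonempty hFne
  have hf : f ∈ F := hfF.1
  have hopt : ∀ f' ∈ fracFeasible M b W, ∑ v, a v * f' v ≤ ∑ v, a v * f v := fun f' hf' => by
    rw [hf.2]
    exact hgr.2 ⟨f', hf', rfl⟩
  refine ⟨f, hf.1, ⟨hf.1.1, fun g hgs hgT => ?_⟩, hf.2⟩
  have hz : ∀ v, f v = 0 → g v = 0 := fun v hv => by
    by_contra h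
    exact hgs h hv
  have hgn : ∀ p, IsTight M b f p → ∑ v ∈ p.2, (-g) v = 0 := fun p hp => by
    simpa using hgT p hp
  have hgW : Function.support g ⊆ W := hgs.trans hf.1.2
  have hgnW : Function.support (-g) ⊆ W := by rwa [Function.support_neg]
  have h1 := sum_mul_nonpos_of_direction hf.1 hopt hgW (fun v hv => (hz v hv).ge)
    fun p hp => (hgT p hp).le
  have h2 := sum_mul_nonpos_of_direction hf.1 hopt hgnW
    (fun v hv => by simp [hz v hv]) fun p hp => (hgn p hp).le
  have h3 : ∑ v, a v * g v = 0 := by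
    simp only [Pi.neg_apply, mul_neg, Finset.sum_neg_distrib] at h2
    linarith
  obtain ⟨t, ⟨ht1, ht2⟩, ht0⟩ := (((eventually_add_smul_mem hf.1.1 (fun v hv => (hz v hv).ge)
    fun p hp => (hgT p hp).le).and (eventually_add_smul_mem hf.1.1
      (fun v hv => by simp [hz v hv]) fun p hp => (hgn p hp).le)).and self_mem_nhdsWithin).exists
  have ht0' : (0 : ℝ) < t := ht0
  have hmem : ∀ d : V → ℝ, Function.support d ⊆ W → ∑ v, a v * d v = 0 →
      f + t • d ∈ ⋂ i, skewPolytope (b i) (M i) → f + t • d ∈ F := fun d hd h0 hm => by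
    refine ⟨⟨hm, (Function.support_add _ _).trans (Set.union_subset hf.1.2
      ((Function.support_const_smul_subset _ _).trans hd))⟩, ?_⟩
    have h2 : ∑ v, a v * (f + t • d) v = ∑ v, a v * f v + t * ∑ v, a v * d v := by
      rw [Finset.mul_sum, ← Finset.sum_add_distrib]
      exact Finset.sum_congr rfl fun v _ => by
        simp only [Pi.add_apply, Pi.smul_apply, smul_eq_mul]; ring
    change ∑ v, a v * (f + t • d) v = _
    rw [h2, h0, mul_zero, add_zero, hf.2]
  have h5 := hfF.2 (hmem g hgW h3 ht1) (hmem (-g) hgnW (by simpa using h3) ht2)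
    ⟨1 / 2, 1 / 2, by norm_num, by norm_num, by norm_num, by
      ext v; simp only [Pi.add_apply, Pi.smul_apply, smul_eq_mul, Pi.neg_apply]; ring⟩
  have h6 : t • g = 0 := by simpa using h5
  exact (smul_eq_zero.1 h6).resolve_left ht0'.ne'

/-! ### The support of a vertex -/

/-- Two tight sets of positive rank in the same matroid are equal once their ranks are equal. Strict
submodularity makes them comparable, and `f(A) ≤ f(B)` for `A ⊂ B` would contradict the strict
decrease of the bounds. -/
theorem IsTight.eq_of_matroidRank_eq {V : Type*} [DecidableEq V] {r : ℕ} [NeZero r]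
    {M : Fin r → Matroid V} {b : Fin r → Finset V → ℝ} (hb : ∀ i, IsStrictPDS (b i))
    {f : V → ℝ} (hf : f ∈ ⋂ i, skewPolytope (b i) (M i)) {i : Fin r} {A B : Finset V}
    (hA : IsTight M b f (i, A)) (hB : IsTight M b f (i, B))
    (h0 : 0 < matroidRank (M i) A) (h : matroidRank (M i) A = matroidRank (M i) B) : A = B := by
  obtain ⟨hn, hle⟩ := mem_iInter_skewPolytope.1 hf
  have key : ∀ A B : Finset V, IsTight M b f (i, A) → IsTight M b f (i, B) →
      0 < matroidRank (M i) A → matroidRank (M i) A = matroidRank (M i) B → ¬ A ⊂ B := by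
    intro A B hA hB h0 h hs
    have h1 : ∑ v ∈ A, f v ≤ ∑ v ∈ B, f v :=
      Finset.sum_le_sum_of_subset_of_nonneg hs.subset fun v _ _ => hn v
    have h2 := (hb i).decreasing A B hs
    have h3 : (0 : ℝ) < matroidRank (M i) A := Nat.cast_pos.2 h0
    have h4 := mul_lt_mul_of_pos_right h2 h3
    have h5 := hA.2
    have h6 := hB.2
    simp only at h5 h6
    rw [← h] at h6
    linarith
  by_contra hne
  have hAB : ¬ A ⊆ B := fun hs => key A B hA hB h0 h (hs.ssubset_of_ne hne)
  have hBA : ¬ B ⊆ A := fun hs =>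
    key B A hB hA (h ▸ h0) h.symm (hs.ssubset_of_ne (Ne.symm hne))
  have h1 := (hb i).mul_matroidRank_lt (M i) hAB hBA h0
  have h2 := Finset.sum_union_inter (s₁ := A) (s₂ := B) (f := f)
  have h3 := hA.2
  have h4 := hB.2
  have h5 := hle (i, A ∪ B) (hA.1.mono Finset.subset_union_left)
  have h6 : ∑ v ∈ A ∩ B, f v ≤ b i (A ∩ B) * (matroidRank (M i) (A ∩ B) : ℝ) := by
    by_cases hne : (A ∩ B).Nonempty
    · exact hle (i, A ∩ B) hne
    · rw [Finset.not_nonempty_iff_eq_empty.1 hne, Finset.sum_empty]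
      exact mul_nonneg ((hb i).pos _).le (Nat.cast_nonneg _)
  simp only at h3 h4 h5
  linarith

/-- A vertex has at most as many nonzero coordinates as there are tight constraints of positive
rank, and in each of the `r` matroids these have distinct ranks. -/
theorem IsVertex.card_support_le [DecidableEq V] [NeZero r] (hb : ∀ i, IsStrictPDS (b i))
    {f : V → ℝ} (hf : IsVertex M b f) {N : ℕ}
    (hN : ∀ p, IsTight M b f p → matroidRank (M p.1) p.2 ≤ N) :
    (Finset.univ.filter fun v => f v ≠ 0).card ≤ r * N := by
  classical
  set S : Finset V := Finset.univ.filter fun v => f v ≠ 0 with hS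
  set T : Finset (Fin r × Finset V) :=
    Finset.univ.filter fun p => IsTight M b f p ∧ 0 < matroidRank (M p.1) p.2 with hT
  have hTN : T.card ≤ r * N := by
    have h : T.card ≤ ((Finset.univ : Finset (Fin r)) ×ˢ Finset.Icc 1 N).card := by
      refine Finset.card_le_card_of_injOn (fun p => (p.1, matroidRank (M p.1) p.2)) ?_ ?_
      · intro p hp
        obtain ⟨-, h1, h2⟩ := Finset.mem_filter.1 (Finset.mem_coe.1 hp)
        exact Finset.mem_coe.2 (Finset.mem_product.2 ⟨Finset.mem_univ _,
          Finset.mem_Icc.2 ⟨h2, hN p h1⟩⟩)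
      · rintro ⟨i, A⟩ hp ⟨j, B⟩ hq h
        obtain ⟨-, h1, h2⟩ := Finset.mem_filter.1 (Finset.mem_coe.1 hp)
        obtain ⟨-, h3, h4⟩ := Finset.mem_filter.1 (Finset.mem_coe.1 hq)
        obtain ⟨rfl, h5⟩ := Prod.mk.inj h
        rw [IsTight.eq_of_matroidRank_eq hb hf.1 h1 h3 h2 h5]
    simpa using h
  refine le_trans ?_ hTN
  let ext0 : (S → ℝ) → V → ℝ := fun g v => if h : v ∈ S then g ⟨v, h⟩ else 0
  have hadd : ∀ g g', ext0 (g + g') = ext0 g + ext0 g' := fun g g' => by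
    ext v; by_cases h : v ∈ S <;> simp [ext0, h]
  have hsmul : ∀ (c : ℝ) g, ext0 (c • g) = c • ext0 g := fun c g => by
    ext v; by_cases h : v ∈ S <;> simp [ext0, h]
  let L : (S → ℝ) →ₗ[ℝ] (T → ℝ) :=
    { toFun := fun g p => ∑ v ∈ p.1.2, ext0 g v
      map_add' := fun g g' => by ext p; simp [hadd, Finset.sum_add_distrib]
      map_smul' := fun c g => by ext p; simp [hsmul, Finset.mul_sum] }
  have hL : Function.Injective L := by
    refine (injective_iff_map_eq_zero L).2 fun g hg => ?_
    have hsupp : Function.support (ext0 g) ⊆ Function.support f := fun v hv => by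
      by_contra h
      exact hv (dif_neg fun hm => h (by simpa [hS] using hm))
    have h0 : ext0 g = 0 := hf.2 _ hsupp fun p hp => by
      rcases Nat.eq_zero_or_pos (matroidRank (M p.1) p.2) with h | h
      · refine Finset.sum_eq_zero fun v hv => ?_
        by_contra hne
        exact hsupp hne (eq_zero_of_matroidRank_eq_zero hf.1 h hv)
      · exact congrFun hg ⟨p, Finset.mem_filter.2 ⟨Finset.mem_univ _, hp, h⟩⟩
    ext v
    have := congrFun h0 v.1
    simpa [ext0] using this
  have := card_le_of_injective ℝ L hL
  simpa using this

/-! ### Faces containing the support of a common optimum -/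

/-- If a feasible `f` is optimal among the points supported in `U` and among those supported in
`U'`, then, under nondegeneracy, also among those supported in `U ∪ U'`. -/
theorem IsNondegenerate.sum_mul_le_of_union [DecidableEq V] [NeZero r]
    (hnd : IsNondegenerate M b) {a f : V → ℝ} {U U' : Finset V}
    (hfU : f ∈ fracFeasible M b U) (hfU' : f ∈ fracFeasible M b U')
    (hopt : ∀ f' ∈ fracFeasible M b U, ∑ v, a v * f' v ≤ ∑ v, a v * f v)
    (hopt' : ∀ f' ∈ fracFeasible M b U', ∑ v, a v * f' v ≤ ∑ v, a v * f v) :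
    ∀ f' ∈ fracFeasible M b (U ∪ U'), ∑ v, a v * f' v ≤ ∑ v, a v * f v := by
  intro f' hf'
  obtain ⟨hn, hle⟩ := mem_iInter_skewPolytope.1 hfU.1
  obtain ⟨hn', hle'⟩ := mem_iInter_skewPolytope.1 hf'.1
  -- The feasible direction `f' - f` is split into `d₁`, supported in `U`, and `d₂`, supported in
  -- `U'`. The correction `w` on the support of `f` keeps `d₂` parallel to the tight constraints.
  set q : V → ℝ := fun v => if v ∈ U then 0 else f' v - f v with hq
  obtain ⟨w, hws, hwT⟩ := hnd f hfU.1 fun p => ∑ v ∈ p.2, q v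
  have hw0 : ∀ v, f v = 0 → w v = 0 := fun v hv => by
    by_contra h
    exact hws h hv
  set d₂ : V → ℝ := q - w with hd2
  set d₁ : V → ℝ := (f' - f) - d₂ with hd1
  have hq0 : ∀ v, f v = 0 → 0 ≤ q v ∧ q v ≤ f' v := fun v hv => by
    by_cases h : v ∈ U <;> simp [hq, h, hv, hn']
  have hloop : ∀ p : Fin r × Finset V, matroidRank (M p.1) p.2 = 0 → ∀ v ∈ p.2,
      d₁ v = 0 ∧ d₂ v = 0 := fun p hp v hv => by
    have h1 := eq_zero_of_matroidRank_eq_zero hfU.1 hp hv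
    have h2 := eq_zero_of_matroidRank_eq_zero hf'.1 hp hv
    have h3 := hw0 v h1
    have h4 : q v = 0 := by simp [hq, h1, h2]
    simp [hd1, hd2, h1, h2, h3, h4]
  have hT2 : ∀ p, IsTight M b f p → ∑ v ∈ p.2, d₂ v = 0 := fun p hp => by
    rcases Nat.eq_zero_or_pos (matroidRank (M p.1) p.2) with h | h
    · exact Finset.sum_eq_zero fun v hv => (hloop p h v hv).2
    · simp only [hd2, Pi.sub_apply, Finset.sum_sub_distrib]
      rw [hwT p hp h, sub_self]
  have h2 : ∑ v, a v * d₂ v ≤ 0 := by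
    refine sum_mul_nonpos_of_direction hfU' hopt' (fun v hv => ?_) (fun v hv => ?_)
      fun p hp => (hT2 p hp).le
    · by_contra hvU'
      refine hv ?_
      have h1 : f v = 0 := by
        by_contra h
        exact hvU' (hfU'.2 h)
      have h3 : q v = 0 := by
        by_cases hvU : v ∈ U
        · simp [hq, hvU]
        · have : f' v = 0 := by
            by_contra h
            rcases Finset.mem_union.1 (Finset.mem_coe.1 (hf'.2 h)) with h' | h'
            · exact hvU h'
            · exact hvU' h'
          simp [hq, h1, this]
      simp [hd2, h3, hw0 v h1]
    · simp [hd2, hw0 v hv, hq0 v hv]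
  have h1 : ∑ v, a v * d₁ v ≤ 0 := by
    refine sum_mul_nonpos_of_direction hfU hopt (fun v hv => ?_) (fun v hv => ?_)
      fun p hp => ?_
    · by_contra hvU
      refine hv ?_
      have h1 : f v = 0 := by
        by_contra h
        exact hvU (hfU.2 h)
      have : v ∉ U := hvU
      simp [hd1, hd2, hq, this, hw0 v h1]
    · have := (hq0 v hv).2
      simp [hd1, hd2, hw0 v hv, hv, this]
    · have h3 := hle' p hp.1
      have h4 := hp.2
      have h5 := hT2 p hp
      simp only [hd1, Pi.sub_apply, Finset.sum_sub_distrib] at h5 ⊢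
      linarith
  have h3 : ∑ v, a v * f' v = ∑ v, a v * f v + ∑ v, a v * d₁ v + ∑ v, a v * d₂ v := by
    rw [← Finset.sum_add_distrib, ← Finset.sum_add_distrib]
    refine Finset.sum_congr rfl fun v _ => ?_
    simp only [hd1, Pi.sub_apply]
    ring
  linarith

/-! ### Collapsing for generic data -/

/-- For generic data, the sequence of collapses at the supports of the vertices, in the order of
decreasing value below `k`, removes all faces. -/
theorem isDCollapsible_of_isNondegenerate [NeZero r] {a : V → ℝ}
    (hb : ∀ i A, 0 ≤ b i A) (hnd : IsNondegenerate M b)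
    (hsep : ∀ f f', IsVertex M b f → IsVertex M b f' →
      ∑ v, a v * f v = ∑ v, a v * f' v → f = f') (d : ℕ) (k : ℝ)
    (hd : ∀ W, fracValue M a b W < k → ∀ f ∈ fracFeasible M b W, IsVertex M b f →
      (Finset.univ.filter fun v => f v ≠ 0).card ≤ d) :
    IsDCollapsible d (fracComplex M a b hb k) := by
  classical
  induction hn : (Finset.univ.filter fun W => fracValue M a b W < k).card
    using Nat.strong_induction_on generalizing k with
  | _ n ih =>
  subst hn
  by_cases hne : (Finset.univ.filter fun W => fracValue M a b W < k).Nonempty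
  swap
  · have : fracComplex M a b hb k = ⊥ := by
      refine LowerSet.ext (Set.eq_empty_iff_forall_notMem.2 fun W hW => hne ⟨W, ?_⟩)
      exact Finset.mem_filter.2 ⟨Finset.mem_univ _, hW⟩
    rw [this]
    exact Relation.ReflTransGen.refl
  obtain ⟨W₀, hW₀, hmax⟩ := Finset.exists_max_image _ (fracValue M a b) hne
  replace hW₀ : fracValue M a b W₀ < k := (Finset.mem_filter.1 hW₀).2
  replace hmax : ∀ W, fracValue M a b W < k → fracValue M a b W ≤ fracValue M a b W₀ :=
    fun W hW => hmax W (Finset.mem_filter.2 ⟨Finset.mem_univ _, hW⟩)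
  obtain ⟨f, hfW, hfv, hfval⟩ := exists_isVertex_sum_eq_fracValue (M := M) a hb W₀
  set σ : Finset V := Finset.univ.filter fun v => f v ≠ 0 with hσ
  have hσs : (σ : Set V) = Function.support f := by ext v; simp [hσ]
  have hfeas : ∀ W, σ ⊆ W → f ∈ fracFeasible M b W := fun W hW =>
    ⟨hfv.1, hσs ▸ Finset.coe_subset.2 hW⟩
  have hval : ∀ W, σ ⊆ W → fracValue M a b W₀ ≤ fracValue M a b W := fun W hW => by
    rw [← hfval]
    exact (fracValue_isGreatest M a b hb W).2 ⟨f, hfeas W hW, rfl⟩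
  have hσW : ∀ W, fracValue M a b W = fracValue M a b W₀ → σ ⊆ W := fun W hW => by
    obtain ⟨g, hgW, hgv, hgval⟩ := exists_isVertex_sum_eq_fracValue (M := M) a hb W
    have : f = g := hsep f g hfv hgv (by rw [hfval, hgval, hW])
    rw [← Finset.coe_subset, hσs, this]
    exact hgW.2
  have hunion : ∀ U U', fracValue M a b U < k → fracValue M a b U' < k → σ ⊆ U → σ ⊆ U' →
      fracValue M a b (U ∪ U') < k := fun U U' hU hU' hσU hσU' => by
    have hopt : ∀ W, fracValue M a b W < k → ∀ f' ∈ fracFeasible M b W,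
        ∑ v, a v * f' v ≤ ∑ v, a v * f v := fun W hW f' hf' => by
      rw [hfval]
      exact ((fracValue_isGreatest M a b hb W).2 ⟨f', hf', rfl⟩).trans (hmax W hW)
    obtain ⟨g, hg, hgval⟩ := (fracValue_isGreatest M a b hb (U ∪ U')).1
    rw [← hgval]
    refine lt_of_le_of_lt ?_ hW₀
    rw [← hfval]
    exact hnd.sum_mul_le_of_union (hfeas U hσU) (hfeas U' hσU') (hopt U hU) (hopt U' hU') g hg
  have hmem : ∀ W (k' : ℝ), W ∈ fracComplex M a b hb k' ↔ fracValue M a b W < k' :=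
    fun W k' => Iff.rfl
  have hσ₀ : σ ⊆ W₀ := hσW W₀ rfl
  have hcollapsor : IsCollapsor (fracComplex M a b hb k) σ := by
    refine ⟨(fracComplex M a b hb k).lower hσ₀ hW₀, ?_⟩
    obtain ⟨τ, hτ₀, hτ⟩ := (Set.toFinite {W | W ∈ fracComplex M a b hb k}).exists_le_maximal hW₀
    refine ⟨τ, ⟨hτ, hσ₀.trans hτ₀⟩, fun τ' h' => ?_⟩
    have hU : τ ∪ τ' ∈ fracComplex M a b hb k :=
      hunion τ τ' hτ.prop h'.1.prop (hσ₀.trans hτ₀) h'.2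
    exact (h'.1.eq_of_le hU Finset.subset_union_right).trans
      (hτ.eq_of_le hU Finset.subset_union_left).symm
  have herase : fracComplex M a b hb (fracValue M a b W₀) =
      (fracComplex M a b hb k).erase σ := by
    refine LowerSet.ext (Set.ext fun W => ?_)
    change fracValue M a b W < fracValue M a b W₀ ↔ fracValue M a b W < k ∧ ¬ σ ⊆ W
    exact ⟨fun h => ⟨h.trans hW₀, fun hs => (hval W hs).not_gt h⟩,
      fun h => (hmax W h.1).lt_of_ne fun he => h.2 (hσW W he)⟩
  refine Relation.ReflTransGen.head
    ⟨σ, hcollapsor, hd W₀ hW₀ f hfW hfv, rfl⟩ (herase ▸ ?_)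
  refine ih _ (Finset.card_lt_card ⟨fun W hW => ?_, fun h => ?_⟩) _
    (fun W hW => hd W (hW.trans hW₀)) rfl
  · simp only [Finset.mem_filter, Finset.mem_univ, true_and] at hW ⊢
    exact hW.trans hW₀
  · have := h (Finset.mem_filter.2 ⟨Finset.mem_univ W₀, hW₀⟩)
    exact lt_irrefl _ (Finset.mem_filter.1 this).2

end Polytope

/-! ### Existence of generic data -/

/-- A nonempty open subset of `ℝ^κ` is not covered by finitely many hyperplanes through `0`. -/
theorem exists_mem_forall_sum_mul_ne_zero {ι κ : Type*} [Finite ι] [Fintype κ] (c : ι → κ → ℝ)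
    {O : Set (κ → ℝ)} (hO : IsOpen O) (hne : O.Nonempty) :
    ∃ x ∈ O, ∀ i, c i ≠ 0 → ∑ j, c i j * x j ≠ 0 := by
  classical
  have hdense : Dense (⋂ i, {x : κ → ℝ | c i ≠ 0 → ∑ j, c i j * x j ≠ 0}) := by
    refine dense_iInter_of_isOpen (fun i => ?_) (fun i => ?_)
    · by_cases h : c i = 0
      · simp [h]
      · simp only [ne_eq, h, not_false_eq_true, true_imp_iff]
        exact isOpen_ne_fun (by fun_prop) (by fun_prop)
    · by_cases h : c i = 0
      · simp [h]
      · let φ : (κ → ℝ) →ₗ[ℝ] ℝ := ∑ j, c i j • LinearMap.proj j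
        have hφ : ∀ x, φ x = ∑ j, c i j * x j := fun x => by simp [φ]
        have hker : LinearMap.ker φ ≠ ⊤ := fun htop => h (funext fun j => by
          have : Pi.single j (1 : ℝ) ∈ LinearMap.ker φ := htop ▸ Submodule.mem_top
          rw [LinearMap.mem_ker, hφ] at this
          simpa [Pi.single_apply] using this)
        have hint : interior (LinearMap.ker φ : Set (κ → ℝ)) = ∅ := by
          by_contra hi
          exact hker ((LinearMap.ker φ).eq_top_of_nonempty_interior'
            (Set.nonempty_iff_ne_empty.2 hi))
        have := interior_eq_empty_iff_dense_compl.1 hint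
        refine this.mono fun x hx _ => ?_
        rw [← hφ]
        exact hx
  obtain ⟨x, hxO, hx⟩ := hdense.inter_open_nonempty O hO hne
  exact ⟨x, hxO, Set.mem_iInter.1 hx⟩

/-- Every nonempty open set of bounds contains nondegenerate ones. If the tight constraints at some
`f` admit a nontrivial linear relation on the support of `f`, then the bounds satisfy the linear
equation with the same coefficients, and only finitely many equations arise in this way. -/
theorem exists_isNondegenerate {V : Type*} [Fintype V] {r : ℕ}
    (M : Fin r → Matroid V) {O : Set (Fin r × Finset V → ℝ)} (hO : IsOpen O) (hne : O.Nonempty) :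
    ∃ x ∈ O, IsNondegenerate M fun i A => x (i, A) := by
  classical
  let L : ∀ (S : Finset V) (T : Finset (Fin r × Finset V)), (V → ℝ) →ₗ[ℝ] (T → ℝ) := fun S T =>
    { toFun := fun w p => ∑ v ∈ p.1.2 with v ∈ S, w v
      map_add' := fun w w' => by ext p; simp [Finset.sum_add_distrib]
      map_smul' := fun t w => by ext p; simp [Finset.mul_sum] }
  have hc : ∀ q : Finset V × Finset (Fin r × Finset V), ∃ c : Fin r × Finset V → ℝ,
      ¬ Function.Surjective (L q.1 q.2) → (∀ p ∈ q.2, 0 < matroidRank (M p.1) p.2) →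
        c ≠ 0 ∧ ∀ (w : V → ℝ) (x : Fin r × Finset V → ℝ),
          (∀ p : q.2, L q.1 q.2 w p = x p * (matroidRank (M p.1.1) p.1.2 : ℝ)) →
            ∑ p, c p * x p = 0 := by
    rintro ⟨S, T⟩
    by_cases hs : Function.Surjective (L S T)
    · exact ⟨0, fun h => absurd hs h⟩
    obtain ⟨φ, hφ0, hφ⟩ := Submodule.exists_le_ker_of_lt_top _
      (lt_top_iff_ne_top.2 fun h => hs (LinearMap.range_eq_top.1 h))
    refine ⟨fun p => if h : p ∈ T then φ (Pi.single ⟨p, h⟩ 1) * (matroidRank (M p.1) p.2 : ℝ)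
      else 0, fun _ hpos => ⟨fun h0 => hφ0 ?_, fun w x hwx => ?_⟩⟩
    · refine LinearMap.pi_ext' fun p => LinearMap.ext_ring ?_
      have h1 := congrFun h0 p.1
      have h2 : (0 : ℝ) < matroidRank (M p.1.1) p.1.2 := Nat.cast_pos.2 (hpos p.1 p.2)
      simpa [h2.ne'] using h1
    · have h1 : φ (L S T w) = 0 := hφ ⟨w, rfl⟩
      refine Eq.trans ?_ h1
      rw [LinearMap.pi_apply_eq_sum_univ φ (L S T w)]
      refine (Finset.sum_subset (Finset.subset_univ T) fun p _ hp => by simp [hp]).symm.trans ?_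
      rw [← Finset.sum_coe_sort T]
      refine Finset.sum_congr rfl fun p _ => ?_
      have h2 := hwx p
      simp only at h2
      simp only [p.2, dif_pos, h2, smul_eq_mul, Subtype.coe_eta]
      have h3 : (fun j => if p = j then (1 : ℝ) else 0) = Pi.single p 1 := by
        ext j; simp [Pi.single_apply, eq_comm]
      rw [h3]
      ring
  choose c hc using hc
  obtain ⟨x, hxO, hx⟩ := exists_mem_forall_sum_mul_ne_zero c hO hne
  refine ⟨x, hxO, fun f _ z => ?_⟩
  set S : Finset V := Finset.univ.filter fun v => f v ≠ 0 with hS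
  set T : Finset (Fin r × Finset V) := Finset.univ.filter fun p =>
    IsTight M (fun i A => x (i, A)) f p ∧ 0 < matroidRank (M p.1) p.2 with hT
  have hsurj : Function.Surjective (L S T) := by
    by_contra hns
    obtain ⟨h1, h2⟩ := hc (S, T) hns fun p hp => (Finset.mem_filter.1 hp).2.2
    refine hx (S, T) h1 (h2 f x fun p => ?_)
    rw [← (Finset.mem_filter.1 p.2).2.1.2]
    refine Finset.sum_subset (Finset.filter_subset _ _) fun v hv hv' => ?_
    by_contra h
    exact hv' (Finset.mem_filter.2 ⟨hv, Finset.mem_filter.2 ⟨Finset.mem_univ _, h⟩⟩)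
  obtain ⟨w, hw⟩ := hsurj fun p => z p
  refine ⟨fun v => if v ∈ S then w v else 0, fun v hv => ?_, fun p hp hr => ?_⟩
  · by_contra h
    exact hv (if_neg fun hm => h (by simpa [hS] using hm))
  · rw [← Finset.sum_filter]
    exact congrFun hw ⟨p, Finset.mem_filter.2 ⟨Finset.mem_univ _, hp, hr⟩⟩

/-- Strictly PDS and nondegenerate bounds lie arbitrarily close above given PDS bounds. -/
theorem exists_isStrictPDS_isNondegenerate {V : Type*} [Fintype V] [DecidableEq V] {r : ℕ}
    (M : Fin r → Matroid V) {b : Fin r → Finset V → ℝ} (hb : ∀ i, IsPDS (b i)) {ε : ℝ}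
    (hε : 0 < ε) :
    ∃ b' : Fin r → Finset V → ℝ, (∀ i, IsStrictPDS (b' i)) ∧ IsNondegenerate M b' ∧
      ∀ i A, b i A < b' i A ∧ b' i A < (1 + ε) * b i A := by
  let O : Set (Fin r × Finset V → ℝ) :=
    (⋂ i, ⋂ A, {x | 0 < x (i, A)}) ∩
    (⋂ i, ⋂ A, ⋂ B, ⋂ _ : A ⊂ B, {x | x (i, B) < x (i, A)}) ∩
    (⋂ i, ⋂ A, ⋂ B, ⋂ _ : ¬ A ⊆ B, ⋂ _ : ¬ B ⊆ A,
      {x | x (i, A ∪ B) + x (i, A ∩ B) < x (i, A) + x (i, B)}) ∩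
    (⋂ i, ⋂ A, {x | b i A < x (i, A)} ∩ {x | x (i, A) < (1 + ε) * b i A})
  have hO : IsOpen O := by
    refine IsOpen.inter (IsOpen.inter (IsOpen.inter ?_ ?_) ?_) ?_
    · exact isOpen_iInter_of_finite fun i => isOpen_iInter_of_finite fun A =>
        isOpen_lt (by fun_prop) (by fun_prop)
    · exact isOpen_iInter_of_finite fun i => isOpen_iInter_of_finite fun A =>
        isOpen_iInter_of_finite fun B => isOpen_iInter_of_finite fun _ =>
        isOpen_lt (by fun_prop) (by fun_prop)
    · exact isOpen_iInter_of_finite fun i => isOpen_iInter_of_finite fun A =>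
        isOpen_iInter_of_finite fun B => isOpen_iInter_of_finite fun _ =>
        isOpen_iInter_of_finite fun _ => isOpen_lt (by fun_prop) (by fun_prop)
    · exact isOpen_iInter_of_finite fun i => isOpen_iInter_of_finite fun A =>
        (isOpen_lt (by fun_prop) (by fun_prop)).inter (isOpen_lt (by fun_prop) (by fun_prop))
  have hmem : ∀ x, x ∈ O ↔ (∀ i, IsStrictPDS fun A => x (i, A)) ∧
      ∀ i A, b i A < x (i, A) ∧ x (i, A) < (1 + ε) * b i A := by
    intro x
    simp only [O, Set.mem_inter_iff, Set.mem_iInter, Set.mem_ofPred_eq]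
    exact ⟨fun h => ⟨fun i => ⟨h.1.1.1 i, h.1.1.2 i, h.1.2 i⟩, h.2⟩,
      fun h => ⟨⟨⟨fun i => (h.1 i).pos, fun i => (h.1 i).decreasing⟩,
        fun i => (h.1 i).submodular⟩, h.2⟩⟩
  choose c hc1 hc2 using fun i => (hb i).exists_isStrictPDS hε
  obtain ⟨x, hxO, hx⟩ := exists_isNondegenerate M hO
    ⟨fun p => c p.1 p.2, (hmem _).2 ⟨hc1, hc2⟩⟩
  exact ⟨fun i A => x (i, A), ((hmem x).1 hxO).1, hx, ((hmem x).1 hxO).2⟩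

/-- Weights that separate the vertices lie arbitrarily close above given positive weights. -/
theorem exists_weight_injOn_isVertex {V : Type*} [Fintype V] {r : ℕ} (M : Fin r → Matroid V)
    (b : Fin r → Finset V → ℝ) {a : V → ℝ} (ha : ∀ v, 0 < a v) {ε : ℝ} (hε : 0 < ε) :
    ∃ a' : V → ℝ, (∀ v, a v < a' v ∧ a' v < (1 + ε) * a v) ∧
      ∀ f f', IsVertex M b f → IsVertex M b f' →
        ∑ v, a' v * f v = ∑ v, a' v * f' v → f = f' := by
  have : Finite {f | IsVertex M b f} := (finite_setOf_isVertex M b).to_subtype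
  obtain ⟨x, hxO, hx⟩ := exists_mem_forall_sum_mul_ne_zero
    (fun q : {f | IsVertex M b f} × {f | IsVertex M b f} => q.1.1 - q.2.1)
    (O := Set.univ.pi fun v => Set.Ioo (a v) ((1 + ε) * a v))
    (isOpen_set_pi Set.finite_univ fun v _ => isOpen_Ioo)
    (Set.univ_pi_nonempty_iff.2 fun v => Set.nonempty_Ioo.2 (by nlinarith [mul_pos hε (ha v)]))
  refine ⟨x, fun v => hxO v (Set.mem_univ v), fun f f' hf hf' h => ?_⟩
  by_contra hne
  refine hx (⟨f, hf⟩, ⟨f', hf'⟩) (sub_ne_zero.2 hne) ?_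
  simp only [Pi.sub_apply, sub_mul, Finset.sum_sub_distrib]
  simp only [mul_comm (f _), mul_comm (f' _), h, sub_self]

/-! ### Comparison of the perturbed and the original data -/

theorem fracValue_le_of_le {V : Type*} [Fintype V] {r : ℕ} [NeZero r] (M : Fin r → Matroid V)
    {a a' : V → ℝ} {b b' : Fin r → Finset V → ℝ} (hb : ∀ i A, 0 ≤ b i A)
    (haa : ∀ v, a v ≤ a' v) (hbb : ∀ i A, b i A ≤ b' i A) (W : Finset V) :
    fracValue M a b W ≤ fracValue M a' b' W := by
  obtain ⟨f, hf, hfv⟩ := (fracValue_isGreatest M a b hb W).1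
  obtain ⟨h0, h1⟩ := mem_iInter_skewPolytope.1 hf.1
  have hf' : f ∈ fracFeasible M b' W := ⟨mem_iInter_skewPolytope.2 ⟨h0, fun p hp =>
    (h1 p hp).trans (mul_le_mul_of_nonneg_right (hbb _ _) (Nat.cast_nonneg _))⟩, hf.2⟩
  rw [← hfv]
  exact (Finset.sum_le_sum fun v _ => mul_le_mul_of_nonneg_right (haa v) (h0 v)).trans
    ((fracValue_isGreatest M a' b' (fun i A => (hb i A).trans (hbb i A)) W).2 ⟨f, hf', rfl⟩)

/-- Scaling a feasible point for `b'` by `1 / s` gives one for `b`. -/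
theorem fracValue_le_mul_of_le_mul {V : Type*} [Fintype V] {r : ℕ} [NeZero r]
    (M : Fin r → Matroid V) {a a' : V → ℝ} {b b' : Fin r → Finset V → ℝ} {s : ℝ} (hs : 0 < s)
    (hb : ∀ i A, 0 ≤ b i A) (hb' : ∀ i A, 0 ≤ b' i A)
    (haa : ∀ v, a' v ≤ s * a v) (hbb : ∀ i A, b' i A ≤ s * b i A) (W : Finset V) :
    fracValue M a' b' W ≤ s ^ 2 * fracValue M a b W := by
  obtain ⟨f, hf, hfv⟩ := (fracValue_isGreatest M a' b' hb' W).1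
  obtain ⟨h0, h1⟩ := mem_iInter_skewPolytope.1 hf.1
  have hf' : s⁻¹ • f ∈ fracFeasible M b W := by
    refine ⟨mem_iInter_skewPolytope.2 ⟨fun v => ?_, fun p hp => ?_⟩,
      (Function.support_const_smul_subset _ _).trans hf.2⟩
    · exact mul_nonneg (inv_nonneg.2 hs.le) (h0 v)
    · simp only [Pi.smul_apply, smul_eq_mul, ← Finset.mul_sum]
      rw [inv_mul_le_iff₀ hs, ← mul_assoc]
      exact (h1 p hp).trans (mul_le_mul_of_nonneg_right (hbb _ _) (Nat.cast_nonneg _))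
  have h2 : ∑ v, a v * (s⁻¹ • f) v ≤ fracValue M a b W :=
    (fracValue_isGreatest M a b hb W).2 ⟨_, hf', rfl⟩
  have h3 : ∑ v, a' v * f v ≤ ∑ v, s ^ 2 * (a v * (s⁻¹ • f) v) :=
    Finset.sum_le_sum fun v _ => by
      have : s ^ 2 * (a v * (s⁻¹ • f) v) = s * a v * f v := by
        simp only [Pi.smul_apply, smul_eq_mul]; field_simp
      rw [this]
      exact mul_le_mul_of_nonneg_right (haa v) (h0 v)
  rw [← Finset.mul_sum] at h3
  simp only at hfv
  rw [← hfv]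
  exact h3.trans (mul_le_mul_of_nonneg_left h2 (by positivity))

theorem theorem3p2 {V : Type*} [Fintype V] [DecidableEq V] [Nonempty V]
    (r : ℕ) [NeZero r]
    (M : Fin r → Matroid V) (hM : ∀ i, (M i).E = Set.univ)
    (a : V → ℝ) (ha : ∀ v, 0 < a v)
    (b : Fin r → Finset V → ℝ) (hb : ∀ i, IsPDS (b i))
    (k : ℝ) (hk : 0 < k) :
    ∃ kbar : ℝ,
      IsGreatest (fracValue M a b '' {W | W ∈ fracComplex M a b (fun i A => ((hb i).pos A).le) k})
        kbar ∧
      kbar < k ∧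
      IsDCollapsible
        (r * ⌊kbar / (Finset.univ.inf' Finset.univ_nonempty a *
          Finset.univ.inf' Finset.univ_nonempty (fun i => b i Finset.univ))⌋₊)
        (fracComplex M a b (fun i A => ((hb i).pos A).le) k) := by
  have hb0 : ∀ i A, 0 ≤ b i A := fun i A => ((hb i).pos A).le
  set α := Finset.univ.inf' Finset.univ_nonempty a with hα
  set β := Finset.univ.inf' Finset.univ_nonempty (fun i => b i Finset.univ) with hβ
  have hα0 : 0 < α := (Finset.lt_inf'_iff _).2 fun v _ => ha v
  have hβ0 : 0 < β := (Finset.lt_inf'_iff _).2 fun i _ => (hb i).pos _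
  have hαa : ∀ v, α ≤ a v := fun v => Finset.inf'_le _ (Finset.mem_univ v)
  have hβb : ∀ i, β ≤ b i Finset.univ := fun i =>
    Finset.inf'_le (fun i => b i Finset.univ) (Finset.mem_univ i)
  have hempty : fracValue M a b ∅ = 0 := by
    obtain ⟨f, hf, hfv⟩ := (fracValue_isGreatest M a b hb0 ∅).1
    have : f = 0 := Function.support_eq_empty_iff.1 (Set.subset_empty_iff.1 (by simpa using hf.2))
    simpa [this] using hfv.symm
  obtain ⟨W₀, hW₀, hmax⟩ := Set.exists_max_image
    {W | W ∈ fracComplex M a b (fun i A => ((hb i).pos A).le) k} (fracValue M a b)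
    (Set.toFinite _) ⟨∅, show fracValue M a b ∅ < k from hempty ▸ hk⟩
  set K := fracValue M a b W₀ with hK
  have hKk : K < k := hW₀
  have hK0 : 0 ≤ K := hempty ▸ fracValue_mono M a b hb0 (Finset.empty_subset W₀)
  refine ⟨K, ⟨⟨W₀, hW₀, rfl⟩, by rintro _ ⟨W, hW, rfl⟩; exact hmax W hW⟩, hKk, ?_⟩
  set N := ⌊K / (α * β)⌋₊ with hN
  have hαβ : 0 < α * β := mul_pos hα0 hβ0
  -- The perturbation multiplies all values by a factor so close to `1` that no face is lost and
  -- the integer part `N` does not grow.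
  obtain ⟨ε, ⟨hε1, hε2⟩, hε⟩ : ∃ ε : ℝ, ((1 + ε) ^ 2 * K < k ∧
      (1 + ε) ^ 2 * K < (N + 1) * (α * β)) ∧ 0 < ε := by
    have hKN : K < (N + 1) * (α * β) := by
      rw [← div_lt_iff₀ hαβ]
      exact Nat.lt_floor_add_one _
    have hc : Tendsto (fun ε : ℝ => (1 + ε) ^ 2 * K) (𝓝[>] 0) (𝓝 K) := by
      have : Continuous fun ε : ℝ => (1 + ε) ^ 2 * K := by fun_prop
      simpa using (this.tendsto 0).mono_left nhdsWithin_le_nhds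
    exact (((hc.eventually_lt_const hKk).and (hc.eventually_lt_const hKN)).and
      self_mem_nhdsWithin).exists
  obtain ⟨b', hb', hnd, hbb⟩ := exists_isStrictPDS_isNondegenerate M hb hε
  obtain ⟨a', haa, hsep⟩ := exists_weight_injOn_isVertex M b' ha hε
  have hb'0 : ∀ i A, 0 ≤ b' i A := fun i A => ((hb' i).pos A).le
  have ha'0 : ∀ v, 0 ≤ a' v := fun v => (ha v).le.trans (haa v).1.le
  have hup : ∀ W, fracValue M a b W < k → fracValue M a' b' W ≤ (1 + ε) ^ 2 * K := fun W hW =>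
    (fracValue_le_mul_of_le_mul M (by linarith) hb0 hb'0 (fun v => (haa v).2.le)
      (fun i A => (hbb i A).2.le) W).trans
      (mul_le_mul_of_nonneg_left (hmax W hW) (by positivity))
  have hlow : ∀ W, fracValue M a b W ≤ fracValue M a' b' W := fun W =>
    fracValue_le_of_le M hb0 (fun v => (haa v).1.le) (fun i A => (hbb i A).1.le) W
  have heq : fracComplex M a b (fun i A => ((hb i).pos A).le) k = fracComplex M a' b' hb'0 k :=
    LowerSet.ext (Set.ext fun W => ⟨fun h => (hup W h).trans_lt hε1,
      fun h => (hlow W).trans_lt h⟩)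
  rw [heq]
  refine isDCollapsible_of_isNondegenerate hb'0 hnd hsep _ _ fun W hW f hfW hf => ?_
  refine hf.card_support_le hb' fun p hp => ?_
  obtain ⟨h0, -⟩ := mem_iInter_skewPolytope.1 hf.1
  have hval : ∑ v, a' v * f v ≤ (1 + ε) ^ 2 * K :=
    ((fracValue_isGreatest M a' b' hb'0 W).2 ⟨f, hfW, rfl⟩).trans (hup W ((hlow W).trans_lt hW))
  have h1 : α * ∑ v ∈ p.2, f v ≤ ∑ v, a' v * f v := by
    rw [Finset.mul_sum]
    refine (Finset.sum_le_sum fun v _ => mul_le_mul_of_nonneg_right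
      ((hαa v).trans (haa v).1.le) (h0 v)).trans ?_
    exact Finset.sum_le_sum_of_subset_of_nonneg (Finset.subset_univ _)
      fun v _ _ => mul_nonneg (ha'0 v) (h0 v)
  have h2 : β ≤ b' p.1 p.2 := (hβb p.1).trans
    (((hb p.1).decreasing _ _ p.2.subset_univ).trans (hbb _ _).1.le)
  rw [hp.2] at h1
  have h3 : α * (β * (matroidRank (M p.1) p.2 : ℝ)) ≤
      α * (b' p.1 p.2 * (matroidRank (M p.1) p.2 : ℝ)) :=
    mul_le_mul_of_nonneg_left (mul_le_mul_of_nonneg_right h2 (Nat.cast_nonneg _)) hα0.le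
  have h4 : (matroidRank (M p.1) p.2 : ℝ) * (α * β) < (N + 1) * (α * β) := by
    calc _ = α * (β * (matroidRank (M p.1) p.2 : ℝ)) := by ring
      _ < _ := by linarith
  exact Nat.lt_succ_iff.1 (by exact_mod_cast lt_of_mul_lt_mul_right h4 hαβ.le)
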